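/- For $n\ge 2$ and $k\ge 0$ let $Q_{n,k}$ be the Gegenbauer polynomial of degree $k$, i.e. the orthogonal polynomial on $[-1,1]$ for the weight $(1-x^2)^{(n-3)/2}$ normalized by $Q_{n,k}(1)=\binom{n+k-1}{n-1}-\binom{n+k-3}{n-1}$. A finite non-empty set $Y$ of unit vectors in $\mathbb{R}^n$ is a spherical design of harmonic index $T\subset\mathbb{N}$ if $\sum_{x\in Y}f(x)=0$ for every real homogeneous harmonic polynomial $f$ in $n$ variables whose degree lies in $T$. For a real polynomial $L$ put $c_L=-\min_{[-1,1]}L$ and $b(L)=(c_L+L(1))/c_L$. A real number $f_4$ is admissible for $n$ if $L_{f_4}=Q_{n,6}+f_4Q_{n,4}$ attains its minimum over $[-1,1]$ at exactly two non-negative points. A spherical design $Y\subset S^{n-1}$ of harmonic index $\{6,4\}$ is called tight if $|Y|=b(L_{f_4})$ for some admissible $f_4$. Put $b_{n,6}=b(Q_{n,6})$. 1. For every $n\ge2$ there is no tight spherical design of harmonic index $\{6,4\}$ on $S^{n-1}$. 2. Let $n\ge 2$ and let $w\in\mathbb{C}$ satisfy $w^2=-(n+6)(n-4)$. For $f_4,s\in\mathbb{C}$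 there are $a,c\in\mathbb{C}$ with $Q_{n,6}(x)+f_4Q_{n,4}(x)=a\,x^2(x^2-s)^2-c$ if and only if, for one of the two choices of sign, $$f_4=\frac{n+10}{10(n+4)(n+6)}\bigl((n+6)(n-12)\pm 2(n+8)w\bigr),\qquad s=\frac{3\bigl(2(n+6)\mp w\bigr)}{(n+4)(n+6)}.$$ 3. For $n\ge5$ every $f_4$ as in 2 is non-real, and no real $f_4$ is admissible. 4. The set of values $b(L_{f_4})$, $f_4$ admissible, is $\{2\}$ for $n=2$, $\{0,3\}$ for $n=3$ and $\{2\}$ for $n=4$. 5. For $n=3$ and $n=4$ every spherical design $Y\subset S^{n-1}$ of harmonic index $\{6\}$ satisfies $|Y|\ge b_{n,6}$, and $b_{n,6}>b(L_{f_4})$ for every admissible $f_4$; moreover $|b_{3,6}-3.41|<0.01$ and $|b_{4,6}-5.29|<0.01$. -/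

import Mathlib

open Polynomial

/-- The real homogeneous harmonic polynomials of degree `k` in `n` indeterminates. -/
def Harm (n k : ℕ) : Set (MvPolynomial (Fin n) ℝ) :=
  {f | f.IsHomogeneous k ∧ ∑ i, MvPolynomial.pderiv i (MvPolynomial.pderiv i f) = 0}

/-- `Y` is a (finite, non-empty) spherical design of harmonic index `T` on the unit sphere
of `ℝⁿ`. -/
def IsHarmonicDesign (n : ℕ) (T : Finset ℕ) (Y : Finset (EuclideanSpace ℝ (Fin n))) : Prop :=
  Y.Nonempty ∧ (∀ x ∈ Y, ‖x‖ = 1) ∧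
    ∀ k ∈ T, ∀ f ∈ Harm n k, ∑ x ∈ Y, MvPolynomial.eval (fun i => x i) f = 0

/-- The coefficient `k / (n + 2k - 2)` of the three-term recurrence below
(`0` for `k = 0`, also when `n = 2`). -/
noncomputable def gegenbauerCoeff (n k : ℕ) : ℝ := (k : ℝ) / ((n : ℝ) + 2 * (k : ℝ) - 2)

/-- The Gegenbauer polynomial `Q_{n,k}` of Delsarte, Goethals and Seidel (for `n ≥ 2`), given by
`Q_{n,0} = 1`, `Q_{n,1} = n x` and `λ_{k+2} Q_{n,k+2} = x Q_{n,k+1} - (1 - λ_k) Q_{n,k}` with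
`λ_k = k / (n + 2k - 2)`.  It is orthogonal with respect to the weight `(1 - x²)^((n-3)/2)` on
`[-1, 1]`, and `Q_{n,k}(1)` is the dimension of the space of harmonic polynomials `Harm n k`. -/
noncomputable def gegenbauerQ (n : ℕ) : ℕ → ℝ[X]
  | 0 => 1
  | 1 => C (n : ℝ) * X
  | k + 2 => C (gegenbauerCoeff n (k + 2))⁻¹ *
      (X * gegenbauerQ n (k + 1) - C (1 - gegenbauerCoeff n k) * gegenbauerQ n k)

/-- The minimum of the polynomial `L` on `[-1, 1]`; it is attained, by compactness. -/
noncomputable def minValue (L : ℝ[X]) : ℝ := sInf ((fun x => L.eval x) '' Set.Icc (-1 : ℝ) 1)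

/-- The non-negative points of `[-1, 1]` at which `L` takes its minimum on `[-1, 1]`. -/
def nonnegMinimizers (L : ℝ[X]) : Set ℝ :=
  {x | x ∈ Set.Icc (-1 : ℝ) 1 ∧ 0 ≤ x ∧ IsMinOn (fun y => L.eval y) (Set.Icc (-1 : ℝ) 1) x}

/-- The Fisher type bound `F(1) / c` given by `F = c + L` with `c = - min L`. -/
noncomputable def fisherBound (L : ℝ[X]) : ℝ := (-minValue L + L.eval 1) / (-minValue L)

/-- `L = Q_{n,t₁} + ∑_{k ∈ T, k ≠ t₁} f_k Q_{n,k}`, where `t₁` is the largest element of `T`. -/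
noncomputable def testCombination (n : ℕ) (T : Finset ℕ) (f : ℕ → ℝ) : ℝ[X] :=
  gegenbauerQ n (T.sup id) + ∑ k ∈ T.erase (T.sup id), C (f k) * gegenbauerQ n k

/-- The coefficients `f` are such that `L` takes its minimum on `[-1, 1]` at exactly `|T|`
non-negative points. -/
def IsAdmissible (n : ℕ) (T : Finset ℕ) (f : ℕ → ℝ) : Prop :=
  (nonnegMinimizers (testCombination n T f)).ncard = T.card

/-- `Y` is a tight spherical design of harmonic index `T`: its size attains the bound
`b_{n,T} = F(1) / c_{n,T}` coming from admissible coefficients.  Where several choices of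
coefficients are admissible, attaining the bound of any one of them counts as tight. -/
def IsTightHarmonicDesign (n : ℕ) (T : Finset ℕ) (Y : Finset (EuclideanSpace ℝ (Fin n))) : Prop :=
  IsHarmonicDesign n T Y ∧
    ∃ f : ℕ → ℝ, IsAdmissible n T f ∧ (Y.card : ℝ) = fisherBound (testCombination n T f)

/-- The polynomial identity `Q_{n,6} + z Q_{n,4} = a x² (x² - s)² - c` over `ℂ`, for some complex
numbers `a` and `c` (here `s` plays the role of `α²`). -/
def IsComplexSolution (n : ℕ) (z s : ℂ) : Prop :=
  ∃ a c : ℂ, (gegenbauerQ n 6).map (algebraMap ℝ ℂ) + C z * (gegenbauerQ n 4).map (algebraMap ℝ ℂ) =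
    C a * X ^ 2 * (X ^ 2 - C s) ^ 2 - C c

/-! ### The Gegenbauer polynomials of degree 4 and 6 -/

/-! In `y = x²` the test polynomial is a cubic with positive leading coefficient. If its minimum
over `[0, 1]` is attained at two points, the cubic minus its minimum is `A (y - y₁)(y - y₂)(y - r)`.
Nonnegativity on `[0, 1]` forces `y₁ = 0` and either a double root `r = y₂` or the boundary case `y₂
= 1 ≤ r`; the latter survives only for `n = 3`, `r = 1`, again a double root. So an admissible `L`
has the form `a x² (x² - s)² - c`.

Comparing coefficients, `x⁴` gives `f₄` as an affine function of `s`, and `x²` then gives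
`(n+6)(n+4) s² - 12(n+6) s + 45 = 0`. Completing the square, `((n+4)(n+6) s - 6(n+6))² =
-9(n+6)(n-4)`. This yields the complex formulas, excludes real solutions for `n ≥ 5`, and leaves
explicit roots for `n = 2, 3, 4`, hence the values of the bound.

Tight designs remain to be excluded for `n ≤ 4`. For `n = 3, 4` the Fisher bound for index 6 alone,
proved with zonal harmonics, exceeds every value of `b`. For `n = 2` the value is 2, and two points
on the circle cannot satisfy both zonal equations (`IsHarmonicDesign.card_ne_two`). -/

theorem gegenbauerQ_add_two {n : ℕ} (k : ℕ) {u v : ℝ} (hu : (gegenbauerCoeff n (k + 2))⁻¹ = u)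
    (hv : 1 - gegenbauerCoeff n k = v) :
    gegenbauerQ n (k + 2) = C u * (X * gegenbauerQ n (k + 1) - C v * gegenbauerQ n k) := by
  rw [← hu, ← hv, gegenbauerQ]

theorem inv_gegenbauerCoeff (n k : ℕ) :
    (gegenbauerCoeff n (k + 2))⁻¹ = ((n : ℝ) + 2 * k + 2) / (k + 2) := by
  rw [gegenbauerCoeff, inv_div]
  push_cast
  ring

/-- The case `k = 0` must be excluded: for `n = 2` the right side would be `0 / 0 = 0`, the left
side `1`. -/
theorem one_sub_gegenbauerCoeff {n k : ℕ} (hn : n ≠ 0) (hk : k ≠ 0) :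
    1 - gegenbauerCoeff n k = ((n : ℝ) + k - 2) / (n + 2 * k - 2) := by
  have h1 : (1 : ℝ) ≤ n := by exact_mod_cast Nat.one_le_iff_ne_zero.mpr hn
  have h2 : (1 : ℝ) ≤ k := by exact_mod_cast Nat.one_le_iff_ne_zero.mpr hk
  have h3 : (n : ℝ) + 2 * k - 2 ≠ 0 := by linarith
  rw [gegenbauerCoeff, one_sub_div h3]
  ring

theorem gegenbauerQ_three (n : ℕ) (hn : n ≠ 0) :
    gegenbauerQ n 3 = C ((n : ℝ) * (n + 4) / 6) * (C ((n : ℝ) + 2) * X ^ 3 - C 3 * X) := by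
  have h0 : (n : ℝ) ≠ 0 := by exact_mod_cast hn
  rw [gegenbauerQ_add_two 1 (inv_gegenbauerCoeff n 1) (one_sub_gegenbauerCoeff hn one_ne_zero),
    gegenbauerQ_add_two 0 (inv_gegenbauerCoeff n 0) rfl, gegenbauerQ, gegenbauerQ]
  refine Polynomial.funext fun x => ?_
  have e1 : (n : ℝ) + 2 * 1 - 2 = n := by ring
  simp only [eval_mul, eval_sub, eval_C, eval_X, eval_pow, eval_one, gegenbauerCoeff]
  norm_num [e1]
  field_simp
  ring

theorem gegenbauerQ_four (n : ℕ) (hn : n ≠ 0) :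
    gegenbauerQ n 4 = C ((n : ℝ) * (n + 6) / 24) *
      (C (((n : ℝ) + 4) * (n + 2)) * X ^ 4 - C (6 * ((n : ℝ) + 2)) * X ^ 2 + C 3) := by
  have h2 : (n : ℝ) + 2 ≠ 0 := by positivity
  have e2 : (n : ℝ) + 2 * 2 - 2 = n + 2 := by ring
  rw [gegenbauerQ_add_two 2 (inv_gegenbauerCoeff n 2) (one_sub_gegenbauerCoeff hn two_ne_zero),
    gegenbauerQ_three n hn, gegenbauerQ_add_two 0 (inv_gegenbauerCoeff n 0) rfl, gegenbauerQ,
    gegenbauerQ]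
  refine Polynomial.funext fun x => ?_
  simp only [eval_mul, eval_sub, eval_add, eval_C, eval_X, eval_pow, eval_one, gegenbauerCoeff,
    Nat.cast_ofNat, e2]
  norm_num
  field_simp
  ring

theorem gegenbauerQ_six (n : ℕ) (hn : n ≠ 0) :
    gegenbauerQ n 6 = C ((n : ℝ) * (n + 2) * (n + 10) / 720) *
      (C (((n : ℝ) + 8) * (n + 6) * (n + 4)) * X ^ 6 - C (15 * ((n : ℝ) + 6) * (n + 4)) * X ^ 4
        + C (45 * ((n : ℝ) + 4)) * X ^ 2 - C 15) := by
  have h4 : (n : ℝ) + 4 ≠ 0 := by positivity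
  have h6 : (n : ℝ) + 6 ≠ 0 := by positivity
  have e3 : (n : ℝ) + 2 * 3 - 2 = n + 4 := by ring
  have e4 : (n : ℝ) + 2 * 4 - 2 = n + 6 := by ring
  rw [gegenbauerQ_add_two 4 (inv_gegenbauerCoeff n 4) (one_sub_gegenbauerCoeff hn four_ne_zero),
    gegenbauerQ_add_two 3 (inv_gegenbauerCoeff n 3) (one_sub_gegenbauerCoeff hn three_ne_zero),
    gegenbauerQ_four n hn, gegenbauerQ_three n hn]
  refine Polynomial.funext fun x => ?_
  simp only [eval_mul, eval_sub, eval_add, eval_C, eval_X, eval_pow, Nat.cast_ofNat, e3, e4]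
  norm_num
  field_simp
  ring

theorem eval_gegenbauerQ_four (n : ℕ) (hn : n ≠ 0) (x : ℝ) :
    (gegenbauerQ n 4).eval x = (n : ℝ) * (n + 6) / 24 *
      (((n : ℝ) + 4) * (n + 2) * x ^ 4 - 6 * ((n : ℝ) + 2) * x ^ 2 + 3) := by
  rw [gegenbauerQ_four n hn]
  simp only [eval_mul, eval_sub, eval_add, eval_C, eval_X, eval_pow]

theorem eval_gegenbauerQ_six (n : ℕ) (hn : n ≠ 0) (x : ℝ) :
    (gegenbauerQ n 6).eval x = (n : ℝ) * (n + 2) * (n + 10) / 720 *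
      (((n : ℝ) + 8) * (n + 6) * (n + 4) * x ^ 6 - 15 * ((n : ℝ) + 6) * (n + 4) * x ^ 4
        + 45 * ((n : ℝ) + 4) * x ^ 2 - 15) := by
  rw [gegenbauerQ_six n hn]
  simp only [eval_mul, eval_sub, eval_add, eval_C, eval_X, eval_pow]

theorem testCombination_six_four (n : ℕ) (f : ℕ → ℝ) :
    testCombination n {6, 4} f = gegenbauerQ n 6 + C (f 4) * gegenbauerQ n 4 := by
  have h1 : ({6, 4} : Finset ℕ).sup id = 6 := by decide
  have h2 : ({6, 4} : Finset ℕ).erase 6 = {4} := by decide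
  simp only [testCombination, h1, h2, Finset.sum_singleton]

theorem eval_testCombination_six_four (n : ℕ) (hn : n ≠ 0) (f : ℕ → ℝ) (x : ℝ) :
    (testCombination n {6, 4} f).eval x = (n : ℝ) * (n + 2) * (n + 10) / 720 *
      (((n : ℝ) + 8) * (n + 6) * (n + 4) * x ^ 6 - 15 * ((n : ℝ) + 6) * (n + 4) * x ^ 4
        + 45 * ((n : ℝ) + 4) * x ^ 2 - 15) + f 4 * ((n : ℝ) * (n + 6) / 24 *
      (((n : ℝ) + 4) * (n + 2) * x ^ 4 - 6 * ((n : ℝ) + 2) * x ^ 2 + 3)) := by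
  rw [testCombination_six_four, eval_add, eval_mul, eval_C, eval_gegenbauerQ_six n hn,
    eval_gegenbauerQ_four n hn]

/-! ### Minima of even sextic polynomials on `[-1, 1]` -/

theorem minValue_eq {L : ℝ[X]} {x₀ m : ℝ} (hx₀ : x₀ ∈ Set.Icc (-1 : ℝ) 1) (h₀ : L.eval x₀ = m)
    (hm : ∀ x ∈ Set.Icc (-1 : ℝ) 1, m ≤ L.eval x) : minValue L = m := by
  refine IsLeast.csInf_eq ⟨⟨x₀, hx₀, h₀⟩, ?_⟩
  rintro _ ⟨x, hx, rfl⟩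
  exact hm x hx

theorem minValue_le (L : ℝ[X]) {x : ℝ} (hx : x ∈ Set.Icc (-1 : ℝ) 1) :
    minValue L ≤ L.eval x :=
  csInf_le (isCompact_Icc.image L.continuous).bddBelow ⟨x, hx, rfl⟩

theorem minValue_of_eval_eq {L : ℝ[X]} {a s c : ℝ} (ha : 0 < a)
    (hL : ∀ x, L.eval x = a * x ^ 2 * (x ^ 2 - s) ^ 2 - c) : minValue L = -c := by
  refine minValue_eq (x₀ := 0) (by simp) (by rw [hL]; ring) fun x _ => ?_
  rw [hL]
  have : 0 ≤ a * x ^ 2 * (x ^ 2 - s) ^ 2 := by positivity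
  linarith

theorem nonnegMinimizers_of_eval_eq {L : ℝ[X]} {a s c : ℝ} (ha : 0 < a) (hs : 0 < s)
    (hs1 : s ≤ 1) (hL : ∀ x, L.eval x = a * x ^ 2 * (x ^ 2 - s) ^ 2 - c) :
    nonnegMinimizers L = {0, √s} := by
  have hmin : ∀ x, -c ≤ L.eval x := fun x => by
    rw [hL]
    have : 0 ≤ a * x ^ 2 * (x ^ 2 - s) ^ 2 := by positivity
    linarith
  ext x
  simp only [nonnegMinimizers, Set.mem_ofPred_eq, Set.mem_insert_iff, Set.mem_singleton_iff]
  constructor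
  · rintro ⟨-, hx0, hx⟩
    have h0 : L.eval x ≤ L.eval 0 := hx (by simp : (0 : ℝ) ∈ Set.Icc (-1 : ℝ) 1)
    rw [hL, hL] at h0
    have h1 : a * x ^ 2 * (x ^ 2 - s) ^ 2 = 0 :=
      le_antisymm (by linarith) (by positivity)
    rcases mul_eq_zero.mp h1 with h2 | h2
    · left
      rcases mul_eq_zero.mp h2 with h3 | h3
      · exact absurd h3 ha.ne'
      · exact pow_eq_zero_iff two_ne_zero |>.mp h3
    · right
      have h3 : x ^ 2 = s := by
        have := pow_eq_zero_iff two_ne_zero |>.mp h2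
        linarith
      rw [← h3, Real.sqrt_sq hx0]
  · have hmem : ∀ x, L.eval x = -c → IsMinOn (fun y => L.eval y) (Set.Icc (-1 : ℝ) 1) x :=
      fun x hx y _ => by
        change L.eval x ≤ L.eval y
        rw [hx]; exact hmin y
    rintro (rfl | rfl)
    · exact ⟨by simp, le_rfl, hmem _ (by rw [hL]; ring)⟩
    · refine ⟨⟨by linarith [Real.sqrt_nonneg s], Real.sqrt_le_one.mpr hs1⟩, Real.sqrt_nonneg s,
        hmem _ ?_⟩
      rw [hL, Real.sq_sqrt hs.le]; ring

theorem ncard_nonnegMinimizers_of_eval_eq {L : ℝ[X]} {a s c : ℝ} (ha : 0 < a) (hs : 0 < s)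
    (hs1 : s ≤ 1) (hL : ∀ x, L.eval x = a * x ^ 2 * (x ^ 2 - s) ^ 2 - c) :
    (nonnegMinimizers L).ncard = 2 := by
  rw [nonnegMinimizers_of_eval_eq ha hs hs1 hL, Set.ncard_pair (Real.sqrt_pos.mpr hs).ne]

theorem fisherBound_of_eval_eq {L : ℝ[X]} {a s c : ℝ} (ha : 0 < a)
    (hL : ∀ x, L.eval x = a * x ^ 2 * (x ^ 2 - s) ^ 2 - c) :
    fisherBound L = a * (1 - s) ^ 2 / c := by
  rw [fisherBound, minValue_of_eval_eq ha hL, hL]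
  congr 1 <;> ring

/-- The roots of a cubic with positive leading coefficient that is nonnegative on `[0, 1]` and
vanishes at two points of that interval. -/
theorem roots_of_cubic_nonneg {y₁ y₂ r : ℝ} (h1 : 0 ≤ y₁) (h12 : y₁ < y₂) (h2 : y₂ ≤ 1)
    (h : ∀ y, 0 ≤ y → y ≤ 1 → 0 ≤ (y - y₁) * (y - y₂) * (y - r)) :
    y₁ = 0 ∧ (r = y₂ ∨ (y₂ = 1 ∧ 1 ≤ r)) := by
  have hr : y₂ ≤ r := by
    by_contra! hr
    -- Just below `y₂`, beyond the other two roots, the cubic would be negative.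
    obtain ⟨y, hy, hy2⟩ := exists_between (max_lt h12 hr)
    obtain ⟨hy1, hyr⟩ := max_lt_iff.mp hy
    have := h y (by linarith) (by linarith)
    have : (y - y₁) * (y - y₂) * (y - r) < 0 :=
      mul_neg_of_neg_of_pos (mul_neg_of_pos_of_neg (by linarith) (by linarith)) (by linarith)
    linarith
  constructor
  · by_contra hne
    have h1' : 0 < y₁ := lt_of_le_of_ne h1 (Ne.symm hne)
    have := h 0 le_rfl zero_le_one
    have : 0 < y₁ * y₂ * r := by
      have : 0 < y₂ := by linarith
      have : 0 < r := by linarith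
      positivity
    nlinarith
  · by_contra! hcon
    have hr' : y₂ < r := lt_of_le_of_ne hr (Ne.symm hcon.1)
    have h2' : y₂ < 1 := by
      refine lt_of_le_of_ne h2 fun he => ?_
      have := hcon.2 he
      linarith
    -- Between `y₂` and `r` the cubic is negative, and part of that gap lies in `[0, 1]`.
    obtain ⟨y, hy, hy2⟩ := exists_between (lt_min h2' hr')
    obtain ⟨hy1, hyr⟩ := lt_min_iff.mp hy2
    have := h y (by linarith) (by linarith)
    have : (y - y₁) * (y - y₂) * (y - r) < 0 :=
      mul_neg_of_pos_of_neg (mul_pos (by linarith) (by linarith)) (by linarith)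
    linarith

/-- The roots of the cubic in `y = x²`, after subtracting the minimum, are `0`, `s`, `r`; the last
two equations are Vieta's formulas. -/
theorem exists_roots_of_ncard_nonnegMinimizers {L : ℝ[X]} {A B K D : ℝ} (hA : 0 < A)
    (hL : ∀ x, L.eval x = A * x ^ 6 + B * x ^ 4 + K * x ^ 2 + D)
    (h : (nonnegMinimizers L).ncard = 2) :
    ∃ s r : ℝ, 0 < s ∧ s ≤ 1 ∧ (r = s ∨ (s = 1 ∧ 1 ≤ r)) ∧ B = -A * (s + r) ∧ K = A * (s * r) := by
  obtain ⟨u, v, huv, hset⟩ := Set.ncard_eq_two.mp h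
  wlog hlt : u < v generalizing u v
  · exact this v u huv.symm (by rw [hset, Set.pair_comm])
      (lt_of_le_of_ne (not_lt.mp hlt) huv.symm)
  obtain ⟨⟨-, hu1⟩, hu0, hu⟩ : u ∈ nonnegMinimizers L := by rw [hset]; simp
  obtain ⟨⟨hv', hv1⟩, hv0, hv⟩ : v ∈ nonnegMinimizers L := by rw [hset]; simp
  have hle1 : L.eval u ≤ L.eval v := hu ⟨hv', hv1⟩
  have hle2 : L.eval v ≤ L.eval u := hv ⟨by linarith, hu1⟩
  have heq : L.eval u = L.eval v := le_antisymm hle1 hle2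
  have hlt2 : u ^ 2 < v ^ 2 := by nlinarith
  -- Divided difference of the cubic at `u²` and `v²`, where it takes equal values.
  have hz : A * (u ^ 4 + u ^ 2 * v ^ 2 + v ^ 4) + B * (u ^ 2 + v ^ 2) + K = 0 := by
    have h0 : (v ^ 2 - u ^ 2) *
        (A * (u ^ 4 + u ^ 2 * v ^ 2 + v ^ 4) + B * (u ^ 2 + v ^ 2) + K) = 0 := by
      rw [hL, hL] at heq
      linear_combination -heq
    exact (mul_eq_zero.mp h0).resolve_left (by linarith)
  obtain ⟨r, hr⟩ : ∃ r, B = -A * (u ^ 2 + v ^ 2 + r) :=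
    ⟨-B / A - u ^ 2 - v ^ 2, by field_simp; ring⟩
  have hfac : ∀ y, 0 ≤ y → y ≤ 1 → 0 ≤ (y - u ^ 2) * (y - v ^ 2) * (y - r) := by
    intro y hy0 hy1
    have hy : √y ^ 2 = y := Real.sq_sqrt hy0
    have hle : L.eval u ≤ L.eval (√y) :=
      hu ⟨by linarith [Real.sqrt_nonneg y], Real.sqrt_le_one.mpr hy1⟩
    have e : L.eval (√y) - L.eval u = A * ((y - u ^ 2) * (y - v ^ 2) * (y - r)) := by
      have e4 : √y ^ 4 = y ^ 2 := by linear_combination (√y ^ 2 + y) * hy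
      have e6 : √y ^ 6 = y ^ 3 := by linear_combination (√y ^ 4 + √y ^ 2 * y + y ^ 2) * hy
      rw [hL, hL, hy, e4, e6]
      linear_combination (y - u ^ 2) * hz + (y - u ^ 2) * (y - v ^ 2) * hr
    exact nonneg_of_mul_nonneg_right (by linarith : 0 ≤ A * _) hA
  obtain ⟨h0, hcase⟩ := roots_of_cubic_nonneg (sq_nonneg u) hlt2 (by nlinarith) hfac
  refine ⟨v ^ 2, r, by linarith, by nlinarith, hcase, by rw [hr, h0]; ring, ?_⟩
  have hu4 : u ^ 4 = 0 := by linear_combination u ^ 2 * h0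
  rw [hr, hu4, h0] at hz
  linear_combination hz

/-! ### Admissible coefficients -/

theorem exists_roots_of_isAdmissible {n : ℕ} (hn : n ≠ 0) {f : ℕ → ℝ}
    (h : IsAdmissible n {6, 4} f) :
    ∃ s r : ℝ, 0 < s ∧ s ≤ 1 ∧ (r = s ∨ (s = 1 ∧ 1 ≤ r)) ∧
      30 * f 4 = ((n : ℝ) + 10) * (15 - ((n : ℝ) + 8) * (s + r)) ∧
      6 * ((n : ℝ) + 6) * (s + r) - 45 = ((n : ℝ) + 6) * (n + 4) * (s * r) := by
  have hn0 : (0 : ℝ) < n := by exact_mod_cast Nat.pos_of_ne_zero hn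
  have hcard : ({6, 4} : Finset ℕ).card = 2 := by decide
  rw [IsAdmissible, hcard] at h
  obtain ⟨s, r, hs, hs1, hsr, hB, hK⟩ := exists_roots_of_ncard_nonnegMinimizers
    (A := (n : ℝ) * (n + 2) * (n + 10) / 720 * ((n + 8) * (n + 6) * (n + 4)))
    (B := (n : ℝ) * (n + 2) * (n + 10) / 720 * (-15 * (n + 6) * (n + 4)) +
      f 4 * (n * (n + 6) / 24 * ((n + 4) * (n + 2))))
    (K := (n : ℝ) * (n + 2) * (n + 10) / 720 * (45 * (n + 4)) -
      f 4 * (n * (n + 6) / 24 * (6 * (n + 2))))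
    (D := (n : ℝ) * (n + 2) * (n + 10) / 720 * (-15) + f 4 * (n * (n + 6) / 24 * 3))
    (by positivity)
    (fun x => by rw [eval_testCombination_six_four n hn]; ring) h
  have e1 : 30 * f 4 = ((n : ℝ) + 10) * (15 - ((n : ℝ) + 8) * (s + r)) := by
    have hne : (n : ℝ) * (n + 2) * (n + 4) * (n + 6) ≠ 0 := by positivity
    refine mul_left_cancel₀ hne ?_
    linear_combination 720 * hB
  refine ⟨s, r, hs, hs1, hsr, e1, ?_⟩
  have hne : (n : ℝ) * (n + 2) * (n + 10) * (n + 8) ≠ 0 := by positivity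
  refine mul_left_cancel₀ hne ?_
  linear_combination 720 * hK + (n : ℝ) * (n + 2) * (n + 6) * 6 * e1

/-- The squared positive minimizer `s` is a double root, and determines `f 4`. -/
theorem exists_root_of_isAdmissible {n : ℕ} (hn : 2 ≤ n) {f : ℕ → ℝ}
    (h : IsAdmissible n {6, 4} f) :
    ∃ s : ℝ, s ≤ 1 ∧ 30 * f 4 = ((n : ℝ) + 10) * (15 - 2 * ((n : ℝ) + 8) * s) ∧
      ((n : ℝ) + 6) * (n + 4) * s ^ 2 - 12 * ((n : ℝ) + 6) * s + 45 = 0 := by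
  have hn2 : (2 : ℝ) ≤ n := by exact_mod_cast hn
  obtain ⟨s, r, hs, hs1, rfl | ⟨rfl, hr⟩, h1, h2⟩ := exists_roots_of_isAdmissible (by lia) h
  · exact ⟨r, hs1, by linear_combination h1, by linear_combination -h2⟩
  -- Boundary case `s = 1`: with `r ≥ 1` this forces `n ≤ 3`; `n = 2` reads `3 = 0`, and `n = 3`
  -- gives `r = 1`.
  · have h3 : 6 * (n : ℝ) - 9 = (n + 6) * (n - 2) * r := by linear_combination h2
    have hn3 : n = 2 ∨ n = 3 := by
      have : ((n : ℝ) - 3) * (n + 1) ≤ 0 := by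
        nlinarith [mul_nonneg (mul_nonneg (by linarith : (0 : ℝ) ≤ n + 6)
          (by linarith : (0 : ℝ) ≤ n - 2)) (by linarith : 0 ≤ r - 1)]
      have : (n : ℝ) ≤ 3 := by nlinarith
      have : n ≤ 3 := by exact_mod_cast this
      lia
    rcases hn3 with rfl | rfl
    · norm_num at h3
    · have hr1 : r = 1 := by norm_num at h3; linarith
      subst hr1
      exact ⟨1, le_rfl, by linear_combination h1, by linear_combination -h2⟩

/-- `h1` matches the `x⁴` coefficients and `h2` those of `x²`; `c` is read off from the constant
term. -/
theorem eval_testCombination_of_root {n : ℕ} (hn : n ≠ 0) {f : ℕ → ℝ} {s : ℝ}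
    (h1 : 30 * f 4 = ((n : ℝ) + 10) * (15 - 2 * ((n : ℝ) + 8) * s))
    (h2 : ((n : ℝ) + 6) * (n + 4) * s ^ 2 - 12 * ((n : ℝ) + 6) * s + 45 = 0) (x : ℝ) :
    (testCombination n {6, 4} f).eval x =
      (n : ℝ) * (n + 2) * (n + 10) / 720 * ((n + 8) * (n + 6) * (n + 4)) * x ^ 2 * (x ^ 2 - s) ^ 2
        - n * (n + 10) * (n + 8) / 120 * ((n + 6) * s - 5) := by
  rw [eval_testCombination_six_four n hn]
  linear_combination (n : ℝ) * (n + 6) / 720 * ((n + 4) * (n + 2) * x ^ 4 - 6 * (n + 2) * x ^ 2 + 3)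
    * h1 - (n : ℝ) * (n + 2) * (n + 10) * (n + 8) / 720 * x ^ 2 * h2

theorem isAdmissible_of_root {n : ℕ} (hn : n ≠ 0) {f : ℕ → ℝ} {s : ℝ} (hs : 0 < s) (hs1 : s ≤ 1)
    (h1 : 30 * f 4 = ((n : ℝ) + 10) * (15 - 2 * ((n : ℝ) + 8) * s))
    (h2 : ((n : ℝ) + 6) * (n + 4) * s ^ 2 - 12 * ((n : ℝ) + 6) * s + 45 = 0) :
    IsAdmissible n {6, 4} f := by
  have hn0 : (0 : ℝ) < n := by exact_mod_cast Nat.pos_of_ne_zero hn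
  exact ncard_nonnegMinimizers_of_eval_eq (by positivity) hs hs1
    (eval_testCombination_of_root hn h1 h2)

theorem fisherBound_of_root {n : ℕ} (hn : n ≠ 0) {f : ℕ → ℝ} {s : ℝ}
    (h1 : 30 * f 4 = ((n : ℝ) + 10) * (15 - 2 * ((n : ℝ) + 8) * s))
    (h2 : ((n : ℝ) + 6) * (n + 4) * s ^ 2 - 12 * ((n : ℝ) + 6) * s + 45 = 0) :
    fisherBound (testCombination n {6, 4} f) =
      (n : ℝ) * (n + 2) * (n + 10) / 720 * ((n + 8) * (n + 6) * (n + 4)) * (1 - s) ^ 2 /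
        (n * (n + 10) * (n + 8) / 120 * ((n + 6) * s - 5)) := by
  have hn0 : (0 : ℝ) < n := by exact_mod_cast Nat.pos_of_ne_zero hn
  exact fisherBound_of_eval_eq (by positivity) (eval_testCombination_of_root hn h1 h2)

theorem not_isAdmissible_six_four {n : ℕ} (hn : 5 ≤ n) (f : ℕ → ℝ) :
    ¬ IsAdmissible n {6, 4} f := by
  intro h
  obtain ⟨s, -, -, h2⟩ := exists_root_of_isAdmissible (by lia) h
  have hn5 : (5 : ℝ) ≤ n := by exact_mod_cast hn
  -- Completing the square: the right side is negative for `n ≥ 5`.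
  have e : (((n : ℝ) + 4) * (n + 6) * s - 6 * (n + 6)) ^ 2 = -9 * ((n + 6) * (n - 4)) := by
    linear_combination ((n : ℝ) + 4) * (n + 6) * h2
  nlinarith [sq_nonneg (((n : ℝ) + 4) * (n + 6) * s - 6 * (n + 6)),
    mul_pos (by linarith : (0 : ℝ) < n + 6) (by linarith : (0 : ℝ) < n - 4)]

/-! ### Values of the bound for `n = 2, 3, 4` -/

theorem fisherBound_values_two :
    {b : ℝ | ∃ f : ℕ → ℝ, IsAdmissible 2 {6, 4} f ∧
      b = fisherBound (testCombination 2 {6, 4} f)} = {2} := by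
  ext b
  simp only [Set.mem_ofPred_eq, Set.mem_singleton_iff]
  constructor
  · rintro ⟨f, hf, rfl⟩
    obtain ⟨s, hs1, h1, h2⟩ := exists_root_of_isAdmissible le_rfl hf
    rw [fisherBound_of_root two_ne_zero h1 h2]
    have hs : s = 3 / 4 := by
      -- The root `5/4` is excluded by `s ≤ 1`.
      have h0 : (4 * s - 3) * (4 * s - 5) = 0 := by
        push_cast at h2
        linear_combination h2 / 3
      rcases mul_eq_zero.mp h0 with h | h <;> linarith
    rw [hs]; norm_num
  · rintro rfl
    -- The value of `f 4` is dictated by this equation at `s = 3/4`; other values of `f` do not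
    -- matter.
    have h1 : 30 * (fun _ => 0 : ℕ → ℝ) 4 =
      (((2 : ℕ) : ℝ) + 10) * (15 - 2 * (((2 : ℕ) : ℝ) + 8) * (3 / 4)) := by norm_num
    have h2 : (((2 : ℕ) : ℝ) + 6) * ((2 : ℕ) + 4) * (3 / 4 : ℝ) ^ 2 -
      12 * (((2 : ℕ) : ℝ) + 6) * (3 / 4) + 45 = 0 := by norm_num
    refine ⟨_, isAdmissible_of_root (f := fun _ => 0)
      two_ne_zero (by norm_num) (by norm_num) h1 h2, ?_⟩
    rw [fisherBound_of_root (f := fun _ => 0) two_ne_zero h1 h2]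
    norm_num

theorem fisherBound_values_three :
    {b : ℝ | ∃ f : ℕ → ℝ, IsAdmissible 3 {6, 4} f ∧
      b = fisherBound (testCombination 3 {6, 4} f)} = {0, 3} := by
  ext b
  simp only [Set.mem_ofPred_eq, Set.mem_insert_iff, Set.mem_singleton_iff]
  constructor
  · rintro ⟨f, hf, rfl⟩
    obtain ⟨s, hs1, h1, h2⟩ := exists_root_of_isAdmissible (by lia) hf
    rw [fisherBound_of_root three_ne_zero h1 h2]
    have h0 : (s - 1) * (7 * s - 5) = 0 := by
      push_cast at h2
      linear_combination h2 / 9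
    rcases mul_eq_zero.mp h0 with h | h
    -- At `s = 1` the endpoint `1` is a minimizer, so the numerator of the bound vanishes.
    · left
      rw [sub_eq_zero.mp h]; norm_num
    · right
      rw [show s = 5 / 7 by linarith]; norm_num
  · rintro (rfl | rfl)
    · have h1 : 30 * (fun _ => -91 / 30 : ℕ → ℝ) 4 =
        (((3 : ℕ) : ℝ) + 10) * (15 - 2 * (((3 : ℕ) : ℝ) + 8) * 1) := by norm_num
      have h2 : (((3 : ℕ) : ℝ) + 6) * ((3 : ℕ) + 4) * (1 : ℝ) ^ 2 -
        12 * (((3 : ℕ) : ℝ) + 6) * 1 + 45 = 0 := by norm_num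
      refine ⟨_, isAdmissible_of_root (f := fun _ => -91 / 30)
      three_ne_zero (by norm_num) (by norm_num) h1 h2, ?_⟩
      rw [fisherBound_of_root (f := fun _ => -91 / 30) three_ne_zero h1 h2]
      norm_num
    · have h1 : 30 * (fun _ => -13 / 42 : ℕ → ℝ) 4 =
        (((3 : ℕ) : ℝ) + 10) * (15 - 2 * (((3 : ℕ) : ℝ) + 8) * (5 / 7)) := by norm_num
      have h2 : (((3 : ℕ) : ℝ) + 6) * ((3 : ℕ) + 4) * (5 / 7 : ℝ) ^ 2 -
        12 * (((3 : ℕ) : ℝ) + 6) * (5 / 7) + 45 = 0 := by norm_num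
      refine ⟨_, isAdmissible_of_root (f := fun _ => -13 / 42)
      three_ne_zero (by norm_num) (by norm_num) h1 h2, ?_⟩
      rw [fisherBound_of_root (f := fun _ => -13 / 42) three_ne_zero h1 h2]
      norm_num

theorem fisherBound_values_four :
    {b : ℝ | ∃ f : ℕ → ℝ, IsAdmissible 4 {6, 4} f ∧
      b = fisherBound (testCombination 4 {6, 4} f)} = {2} := by
  ext b
  simp only [Set.mem_ofPred_eq, Set.mem_singleton_iff]
  constructor
  · rintro ⟨f, hf, rfl⟩
    obtain ⟨s, hs1, h1, h2⟩ := exists_root_of_isAdmissible (by lia) hf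
    rw [fisherBound_of_root four_ne_zero h1 h2]
    have hs : s = 3 / 4 := by
      have h0 : (4 * s - 3) ^ 2 = 0 := by
        push_cast at h2
        linear_combination h2 / 5
      have := pow_eq_zero_iff two_ne_zero |>.mp h0
      linarith
    rw [hs]; norm_num
  · rintro rfl
    have h1 : 30 * (fun _ => -7 / 5 : ℕ → ℝ) 4 =
      (((4 : ℕ) : ℝ) + 10) * (15 - 2 * (((4 : ℕ) : ℝ) + 8) * (3 / 4)) := by norm_num
    have h2 : (((4 : ℕ) : ℝ) + 6) * ((4 : ℕ) + 4) * (3 / 4 : ℝ) ^ 2 -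
      12 * (((4 : ℕ) : ℝ) + 6) * (3 / 4) + 45 = 0 := by norm_num
    refine ⟨_, isAdmissible_of_root (f := fun _ => -7 / 5)
      four_ne_zero (by norm_num) (by norm_num) h1 h2, ?_⟩
    rw [fisherBound_of_root (f := fun _ => -7 / 5) four_ne_zero h1 h2]
    norm_num

/-! ### The complex identity -/

theorem even_sextic_eq_zero {p q r t : ℂ}
    (h : ∀ x : ℂ, p * x ^ 6 + q * x ^ 4 + r * x ^ 2 + t = 0) :
    p = 0 ∧ q = 0 ∧ r = 0 ∧ t = 0 := by
  have h0 := h 0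
  have h1 := h 1
  have h2 := h 2
  have h3 := h 3
  have ht : t = 0 := by linear_combination h0
  -- Second divided difference of `p y² + q y + r` at the nodes `y = 1, 4, 9`.
  have hp : p = 0 := by linear_combination (h3 - ht) / 360 - (h2 - ht) / 60 + (h1 - ht) / 24
  have hq : q = 0 := by linear_combination ((h2 - ht) / 4 - (h1 - ht)) / 3 - 5 * hp
  exact ⟨hp, hq, by linear_combination h1 - ht - hp - hq, ht⟩

/-- The `x⁶` coefficient fixes `a` and the constant term fixes `c`, so only the `x⁴` and `x²`
coefficients constrain `z` and `s`. -/
theorem isComplexSolution_iff {n : ℕ} (hn : n ≠ 0) (z s : ℂ) :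
    IsComplexSolution n z s ↔ 30 * z = ((n : ℂ) + 10) * (15 - 2 * ((n : ℂ) + 8) * s) ∧
      ((n : ℂ) + 6) * (n + 4) * s ^ 2 - 12 * ((n : ℂ) + 6) * s + 45 = 0 := by
  have hne : (n : ℂ) ≠ 0 := by exact_mod_cast hn
  have hne' (k : ℕ) : (n : ℂ) + (k + 1) ≠ 0 := by exact_mod_cast (n + k).succ_ne_zero
  have h2 : (n : ℂ) + 2 ≠ 0 := by simpa [one_add_one_eq_two] using hne' 1
  have h4 : (n : ℂ) + 4 ≠ 0 := by convert hne' 3 using 2; norm_num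
  have h6 : (n : ℂ) + 6 ≠ 0 := by convert hne' 5 using 2; norm_num
  have h8 : (n : ℂ) + 8 ≠ 0 := by convert hne' 7 using 2; norm_num
  have h10 : (n : ℂ) + 10 ≠ 0 := by convert hne' 9 using 2; norm_num
  have heval (a c : ℂ) : (gegenbauerQ n 6).map (algebraMap ℝ ℂ) +
      C z * (gegenbauerQ n 4).map (algebraMap ℝ ℂ) = C a * X ^ 2 * (X ^ 2 - C s) ^ 2 - C c ↔
      ∀ x : ℂ, (n : ℂ) * (n + 2) * (n + 10) / 720 *
        (((n : ℂ) + 8) * (n + 6) * (n + 4) * x ^ 6 - 15 * ((n : ℂ) + 6) * (n + 4) * x ^ 4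
          + 45 * ((n : ℂ) + 4) * x ^ 2 - 15) + z * ((n : ℂ) * (n + 6) / 24 *
        (((n : ℂ) + 4) * (n + 2) * x ^ 4 - 6 * ((n : ℂ) + 2) * x ^ 2 + 3)) =
        a * x ^ 2 * (x ^ 2 - s) ^ 2 - c := by
    have key : ∀ P Q : ℂ[X], P = Q ↔ ∀ x, P.eval x = Q.eval x :=
      fun P Q => ⟨fun h x => by rw [h], Polynomial.funext⟩
    rw [key, gegenbauerQ_six n hn, gegenbauerQ_four n hn]
    refine forall_congr' fun x => ?_
    simp
  rw [IsComplexSolution]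
  simp only [heval]
  constructor
  · rintro ⟨a, c, h⟩
    obtain ⟨hp, hq, hr, -⟩ := even_sextic_eq_zero
      (p := (n : ℂ) * (n + 2) * (n + 10) / 720 * ((n + 8) * (n + 6) * (n + 4)) - a)
      (q := (n : ℂ) * (n + 2) * (n + 10) / 720 * (-15 * (n + 6) * (n + 4)) +
        z * (n * (n + 6) / 24 * ((n + 4) * (n + 2))) + 2 * a * s)
      (r := (n : ℂ) * (n + 2) * (n + 10) / 720 * (45 * (n + 4)) -
        z * (n * (n + 6) / 24 * (6 * (n + 2))) - a * s ^ 2)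
      (t := (n : ℂ) * (n + 2) * (n + 10) / 720 * (-15) + z * (n * (n + 6) / 24 * 3) + c)
      (fun x => by linear_combination h x)
    have e1 : 30 * z = ((n : ℂ) + 10) * (15 - 2 * ((n : ℂ) + 8) * s) := by
      refine mul_left_cancel₀ (mul_ne_zero (mul_ne_zero (mul_ne_zero hne h2) h4) h6) ?_
      linear_combination 720 * hq + 720 * 2 * s * hp
    refine ⟨e1, ?_⟩
    refine (mul_eq_zero.mp ?_).resolve_left
      (mul_ne_zero (mul_ne_zero (mul_ne_zero hne h2) h10) h8)
    linear_combination -720 * hr + 720 * s ^ 2 * hp - (n : ℂ) * (n + 2) * (n + 6) * 6 * e1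
  · rintro ⟨e1, e2⟩
    refine ⟨(n : ℂ) * (n + 2) * (n + 10) / 720 * ((n + 8) * (n + 6) * (n + 4)),
      n * (n + 10) * (n + 8) / 120 * ((n + 6) * s - 5), fun x => ?_⟩
    linear_combination (n : ℂ) * (n + 6) / 720 *
      ((n + 4) * (n + 2) * x ^ 4 - 6 * (n + 2) * x ^ 2 + 3)
      * e1 - (n : ℂ) * (n + 2) * (n + 10) * (n + 8) / 720 * x ^ 2 * e2

/-- Since `(3w)²` equals `-9(n+6)(n-4)`, the quadratic for `s`, multiplied by `(n+4)(n+6)`, splits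
into two linear factors, one per sign of `w`. -/
theorem isComplexSolution_iff_of_sq {n : ℕ} (hn : n ≠ 0) {w : ℂ}
    (hw : w ^ 2 = -(((n : ℂ) + 6) * ((n : ℂ) - 4))) (z s : ℂ) :
    IsComplexSolution n z s ↔
        (z = ((n : ℂ) + 10) / (10 * ((n : ℂ) + 4) * ((n : ℂ) + 6)) *
              (((n : ℂ) + 6) * ((n : ℂ) - 12) + 2 * ((n : ℂ) + 8) * w) ∧
          s = 3 * (2 * ((n : ℂ) + 6) - w) / (((n : ℂ) + 4) * ((n : ℂ) + 6))) ∨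
        (z = ((n : ℂ) + 10) / (10 * ((n : ℂ) + 4) * ((n : ℂ) + 6)) *
              (((n : ℂ) + 6) * ((n : ℂ) - 12) - 2 * ((n : ℂ) + 8) * w) ∧
          s = 3 * (2 * ((n : ℂ) + 6) + w) / (((n : ℂ) + 4) * ((n : ℂ) + 6))) := by
  have hne' (k : ℕ) : (n : ℂ) + (k + 1) ≠ 0 := by exact_mod_cast (n + k).succ_ne_zero
  have h4 : (n : ℂ) + 4 ≠ 0 := by convert hne' 3 using 2; norm_num
  have h6 : (n : ℂ) + 6 ≠ 0 := by convert hne' 5 using 2; norm_num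
  have hbranch : ∀ v : ℂ,
      ((z = ((n : ℂ) + 10) / (10 * ((n : ℂ) + 4) * ((n : ℂ) + 6)) *
              (((n : ℂ) + 6) * ((n : ℂ) - 12) + 2 * ((n : ℂ) + 8) * v) ∧
          s = 3 * (2 * ((n : ℂ) + 6) - v) / (((n : ℂ) + 4) * ((n : ℂ) + 6))) ↔
        30 * z = ((n : ℂ) + 10) * (15 - 2 * ((n : ℂ) + 8) * s) ∧
          ((n : ℂ) + 4) * (n + 6) * s - 6 * (n + 6) + 3 * v = 0) := by
    intro v
    have es : s = 3 * (2 * ((n : ℂ) + 6) - v) / (((n : ℂ) + 4) * ((n : ℂ) + 6)) ↔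
        ((n : ℂ) + 4) * (n + 6) * s - 6 * (n + 6) + 3 * v = 0 := by
      rw [eq_div_iff (mul_ne_zero h4 h6)]
      constructor <;> intro h <;> linear_combination h
    rw [es]
    refine and_congr_left fun h => ?_
    rw [div_mul_eq_mul_div, eq_div_iff (mul_ne_zero (mul_ne_zero (by norm_num) h4) h6)]
    constructor
    · intro hz
      refine mul_left_cancel₀ (mul_ne_zero h4 h6) ?_
      linear_combination 3 * hz + 2 * ((n : ℂ) + 10) * (n + 8) * h
    · intro hz
      linear_combination ((n : ℂ) + 4) * (n + 6) * hz / 3 - 2 * ((n : ℂ) + 10) * (n + 8) * h / 3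
  have hb2 := hbranch (-w)
  simp only [mul_neg, sub_neg_eq_add, ← sub_eq_add_neg] at hb2
  rw [isComplexSolution_iff hn, hbranch w, hb2, ← and_or_left]
  refine and_congr_right fun _ => ?_
  rw [← mul_eq_zero]
  constructor
  · intro h
    linear_combination ((n : ℂ) + 4) * (n + 6) * h - 9 * hw
  · intro h
    refine (mul_eq_zero.mp ?_).resolve_left (mul_ne_zero h4 h6)
    linear_combination h + 9 * hw

/-- The affine relation with real coefficients makes `s` real if `z` is; a real square would then be
negative. -/
theorem IsComplexSolution.im_ne_zero {n : ℕ} (hn : 5 ≤ n) {z s : ℂ}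
    (h : IsComplexSolution n z s) : z.im ≠ 0 := by
  intro hz
  obtain ⟨h1, h2⟩ := (isComplexSolution_iff (by lia) z s).mp h
  have hn5 : (5 : ℝ) ≤ n := by exact_mod_cast hn
  have hs : s.im = 0 := by
    have h3 := congrArg Complex.im h1
    simp [hz] at h3
    rcases h3 with h3 | h3 | h3
    · exfalso; have := h3; linarith
    · exfalso; have := h3; linarith
    · exact h3
  have h4 := congrArg Complex.re h2
  simp [hs, sq] at h4
  have e : (((n : ℝ) + 4) * (n + 6) * s.re - 6 * (n + 6)) ^ 2 = -9 * ((n + 6) * (n - 4)) := by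
    linear_combination ((n : ℝ) + 4) * (n + 6) * h4
  nlinarith [sq_nonneg (((n : ℝ) + 4) * (n + 6) * s.re - 6 * (n + 6)),
    mul_pos (by linarith : (0 : ℝ) < n + 6) (by linarith : (0 : ℝ) < n - 4)]

/-! ### Zonal harmonic polynomials -/

section Zonal

variable {n : ℕ} (y : Fin n → ℝ)

/-- The linear form `∑ yᵢ Xᵢ`. -/
noncomputable def linearForm : MvPolynomial (Fin n) ℝ :=
  ∑ i, MvPolynomial.C (y i) * MvPolynomial.X i

/-- The quadratic form `∑ Xᵢ²`. -/
noncomputable def normSqForm (n : ℕ) : MvPolynomial (Fin n) ℝ := ∑ i, MvPolynomial.X i ^ 2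

theorem isHomogeneous_linearForm : (linearForm y).IsHomogeneous 1 :=
  MvPolynomial.IsHomogeneous.sum _ _ _ fun i _ => by
    simpa using (MvPolynomial.isHomogeneous_C _ (y i)).mul (MvPolynomial.isHomogeneous_X ℝ i)

theorem isHomogeneous_normSqForm : (normSqForm n).IsHomogeneous 2 :=
  MvPolynomial.IsHomogeneous.sum _ _ _ fun i _ => by
    simpa using (MvPolynomial.isHomogeneous_X ℝ i).pow 2

theorem isHomogeneous_linearForm_pow_mul_normSqForm_pow (c : ℝ) (a b : ℕ) :
    (MvPolynomial.C c * linearForm y ^ a * normSqForm n ^ b).IsHomogeneous (a + 2 * b) := by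
  simpa using ((MvPolynomial.isHomogeneous_C _ c).mul ((isHomogeneous_linearForm y).pow a)).mul
    (isHomogeneous_normSqForm.pow b)

theorem pderiv_linearForm (i : Fin n) :
    MvPolynomial.pderiv i (linearForm y) = MvPolynomial.C (y i) := by
  simp [linearForm, MvPolynomial.pderiv_X, Pi.single_apply]

theorem pderiv_normSqForm (i : Fin n) :
    MvPolynomial.pderiv i (normSqForm n) = 2 * MvPolynomial.X i := by
  simp [normSqForm, MvPolynomial.pderiv_X, Pi.single_apply]

/-- Laplacian of `ℓ^a N^b`, from `|∇ℓ|² = 1`, `∇ℓ · ∇N = 2ℓ`, `|∇N|² = 4N` and `ΔN = 2n`. Where an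
exponent is truncated at zero, its coefficient vanishes. It serves to check that the homogenized
Gegenbauer polynomials are harmonic. -/
theorem sum_pderiv_pderiv_zonal {y : Fin n → ℝ} (hy : ∑ i, y i ^ 2 = 1) (a b : ℕ) :
    ∑ i, MvPolynomial.pderiv i (MvPolynomial.pderiv i
      (linearForm y ^ a * normSqForm n ^ b)) =
      ((a * (a - 1) : ℕ) : MvPolynomial (Fin n) ℝ) *
        (linearForm y ^ (a - 1 - 1) * normSqForm n ^ b) +
      ((4 * a * b : ℕ) : MvPolynomial (Fin n) ℝ) *
        (linearForm y ^ (a - 1) * linearForm y * normSqForm n ^ (b - 1)) +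
      ((4 * b * (b - 1) : ℕ) : MvPolynomial (Fin n) ℝ) *
        (linearForm y ^ a * normSqForm n ^ (b - 1 - 1) * normSqForm n) +
      ((2 * n * b : ℕ) : MvPolynomial (Fin n) ℝ) *
        (linearForm y ^ a * normSqForm n ^ (b - 1)) := by
  have hpoint : ∀ i, MvPolynomial.pderiv i (MvPolynomial.pderiv i
      (linearForm y ^ a * normSqForm n ^ b)) =
      ((a * (a - 1) : ℕ) : MvPolynomial (Fin n) ℝ) *
        (linearForm y ^ (a - 1 - 1) * normSqForm n ^ b) * MvPolynomial.C (y i ^ 2) +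
      ((4 * a * b : ℕ) : MvPolynomial (Fin n) ℝ) *
        (linearForm y ^ (a - 1) * normSqForm n ^ (b - 1)) *
        (MvPolynomial.C (y i) * MvPolynomial.X i) +
      ((4 * b * (b - 1) : ℕ) : MvPolynomial (Fin n) ℝ) *
        (linearForm y ^ a * normSqForm n ^ (b - 1 - 1)) * MvPolynomial.X i ^ 2 +
      ((2 * b : ℕ) : MvPolynomial (Fin n) ℝ) * (linearForm y ^ a * normSqForm n ^ (b - 1)) := by
    intro i
    simp only [MvPolynomial.pderiv_mul, MvPolynomial.pderiv_pow, pderiv_linearForm,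
      pderiv_normSqForm, map_add, MvPolynomial.pderiv_C, MvPolynomial.pderiv_X_self,
      Derivation.map_natCast, MvPolynomial.C_pow]
    have h2 : MvPolynomial.pderiv i (2 : MvPolynomial (Fin n) ℝ) = 0 :=
      Derivation.map_natCast _ 2
    rw [h2]
    push_cast
    ring
  simp only [hpoint, Finset.sum_add_distrib, ← Finset.mul_sum, ← map_sum, hy]
  rw [← linearForm, ← normSqForm]
  simp
  ring

/-- The zonal harmonic polynomial of degree 4 with axis `y`. -/
theorem zonal_four_mem_Harm {y : Fin n → ℝ} (hy : ∑ i, y i ^ 2 = 1) :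
    MvPolynomial.C (((n : ℝ) + 4) * (n + 2)) * linearForm y ^ 4 * normSqForm n ^ 0 +
      MvPolynomial.C (-6 * ((n : ℝ) + 2)) * linearForm y ^ 2 * normSqForm n ^ 1 +
      MvPolynomial.C 3 * linearForm y ^ 0 * normSqForm n ^ 2 ∈ Harm n 4 := by
  refine ⟨((isHomogeneous_linearForm_pow_mul_normSqForm_pow y _ 4 0).add
    (isHomogeneous_linearForm_pow_mul_normSqForm_pow y _ 2 1)).add
    (isHomogeneous_linearForm_pow_mul_normSqForm_pow y _ 0 2), ?_⟩
  simp only [mul_assoc, map_add, MvPolynomial.pderiv_C_mul, Finset.sum_add_distrib,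
    ← Finset.mul_sum, sum_pderiv_pderiv_zonal hy]
  push_cast [map_add, map_mul, map_neg, map_natCast, map_ofNat]
  ring

/-- The zonal harmonic polynomial of degree 6 with axis `y`. -/
theorem zonal_six_mem_Harm {y : Fin n → ℝ} (hy : ∑ i, y i ^ 2 = 1) :
    MvPolynomial.C (((n : ℝ) + 8) * (n + 6) * (n + 4)) * linearForm y ^ 6 * normSqForm n ^ 0 +
      MvPolynomial.C (-15 * ((n : ℝ) + 6) * (n + 4)) * linearForm y ^ 4 * normSqForm n ^ 1 +
      MvPolynomial.C (45 * ((n : ℝ) + 4)) * linearForm y ^ 2 * normSqForm n ^ 2 +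
      MvPolynomial.C (-15) * linearForm y ^ 0 * normSqForm n ^ 3 ∈ Harm n 6 := by
  refine ⟨(((isHomogeneous_linearForm_pow_mul_normSqForm_pow y _ 6 0).add
    (isHomogeneous_linearForm_pow_mul_normSqForm_pow y _ 4 1)).add
    (isHomogeneous_linearForm_pow_mul_normSqForm_pow y _ 2 2)).add
    (isHomogeneous_linearForm_pow_mul_normSqForm_pow y _ 0 3), ?_⟩
  simp only [mul_assoc, map_add, MvPolynomial.pderiv_C_mul, Finset.sum_add_distrib,
    ← Finset.mul_sum, sum_pderiv_pderiv_zonal hy]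
  push_cast [map_add, map_mul, map_neg, map_natCast, map_ofNat]
  ring

end Zonal

/-! ### Zonal sums over designs -/

theorem eval_linearForm {n : ℕ} (x y : EuclideanSpace ℝ (Fin n)) :
    MvPolynomial.eval (fun i => x i) (linearForm fun i => y i) = inner ℝ x y := by
  simp [linearForm, PiLp.inner_apply]

theorem eval_normSqForm {n : ℕ} {x : EuclideanSpace ℝ (Fin n)} (hx : ‖x‖ = 1) :
    MvPolynomial.eval (fun i => x i) (normSqForm n) = 1 := by
  have := EuclideanSpace.real_norm_sq_eq x
  rw [hx] at this
  simpa [normSqForm] using this.symm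

/-- At a unit vector `x` the zonal harmonic with axis `y` is, up to a constant factor, the
Gegenbauer polynomial at `⟨x, y⟩`. -/
theorem IsHarmonicDesign.sum_eval_gegenbauerQ_four {n : ℕ} (hn : n ≠ 0) {T : Finset ℕ}
    {Y : Finset (EuclideanSpace ℝ (Fin n))} (h : IsHarmonicDesign n T Y) (hT : 4 ∈ T)
    {y : EuclideanSpace ℝ (Fin n)} (hy : ‖y‖ = 1) :
    ∑ x ∈ Y, (gegenbauerQ n 4).eval (inner ℝ x y) = 0 := by
  have hy' : ∑ i, y i ^ 2 = 1 := by rw [← EuclideanSpace.real_norm_sq_eq, hy, one_pow]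
  have h0 := h.2.2 4 hT _ (zonal_four_mem_Harm hy')
  rw [← mul_zero ((n : ℝ) * (n + 6) / 24), ← h0, Finset.mul_sum]
  refine Finset.sum_congr rfl fun x hx => ?_
  rw [eval_gegenbauerQ_four n hn]
  simp only [map_add, map_mul, map_pow, MvPolynomial.eval_C, eval_linearForm,
    eval_normSqForm (h.2.1 x hx)]
  ring

theorem IsHarmonicDesign.sum_eval_gegenbauerQ_six {n : ℕ} (hn : n ≠ 0) {T : Finset ℕ}
    {Y : Finset (EuclideanSpace ℝ (Fin n))} (h : IsHarmonicDesign n T Y) (hT : 6 ∈ T)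
    {y : EuclideanSpace ℝ (Fin n)} (hy : ‖y‖ = 1) :
    ∑ x ∈ Y, (gegenbauerQ n 6).eval (inner ℝ x y) = 0 := by
  have hy' : ∑ i, y i ^ 2 = 1 := by rw [← EuclideanSpace.real_norm_sq_eq, hy, one_pow]
  have h0 := h.2.2 6 hT _ (zonal_six_mem_Harm hy')
  rw [← mul_zero ((n : ℝ) * (n + 2) * (n + 10) / 720), ← h0, Finset.mul_sum]
  refine Finset.sum_congr rfl fun x hx => ?_
  rw [eval_gegenbauerQ_six n hn]
  simp only [map_add, map_mul, map_pow, MvPolynomial.eval_C, eval_linearForm,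
    eval_normSqForm (h.2.1 x hx)]
  ring

/-- The Fisher type bound for designs of harmonic index `6`. -/
theorem IsHarmonicDesign.fisherBound_le_card {n : ℕ} (hn : n ≠ 0) {T : Finset ℕ}
    {Y : Finset (EuclideanSpace ℝ (Fin n))} (h : IsHarmonicDesign n T Y) (hT : 6 ∈ T) :
    fisherBound (gegenbauerQ n 6) ≤ Y.card := by
  have hn0 : (0 : ℝ) < n := by exact_mod_cast Nat.pos_of_ne_zero hn
  obtain ⟨y, hyY⟩ := h.1
  have hy := h.2.1 y hyY
  have hneg : minValue (gegenbauerQ n 6) < 0 := by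
    refine (minValue_le _ (x := 0) (by simp)).trans_lt ?_
    rw [eval_gegenbauerQ_six n hn]
    have : 0 < (n : ℝ) * (n + 2) * (n + 10) / 720 := by positivity
    linarith
  have hmem : ∀ x ∈ Y, inner ℝ x y ∈ Set.Icc (-1 : ℝ) 1 := fun x hx => by
    have := abs_real_inner_le_norm x y
    rw [h.2.1 x hx, hy, one_mul] at this
    exact abs_le.mp this
  rw [fisherBound, div_le_iff₀ (by linarith)]
  calc -minValue (gegenbauerQ n 6) + (gegenbauerQ n 6).eval 1
      = -minValue (gegenbauerQ n 6) + (gegenbauerQ n 6).eval (inner ℝ y y) := by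
        rw [real_inner_self_eq_norm_sq, hy, one_pow]
    -- All summands are nonnegative, and the left side is the one with `x = y`.
    _ ≤ ∑ x ∈ Y, (-minValue (gegenbauerQ n 6) + (gegenbauerQ n 6).eval (inner ℝ x y)) :=
        Finset.single_le_sum (f := fun x => -minValue (gegenbauerQ n 6) +
          (gegenbauerQ n 6).eval (inner ℝ x y))
          (fun x hx => by linarith [minValue_le (gegenbauerQ n 6) (hmem x hx)]) hyY
    _ = Y.card * -minValue (gegenbauerQ n 6) := by
        rw [Finset.sum_add_distrib, h.sum_eval_gegenbauerQ_six hn hT hy, Finset.sum_const,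
          nsmul_eq_mul, add_zero]

/-- No two points form a design of harmonic index `{6, 4}` on the circle. -/
theorem IsHarmonicDesign.card_ne_two {Y : Finset (EuclideanSpace ℝ (Fin 2))}
    (h : IsHarmonicDesign 2 {6, 4} Y) : Y.card ≠ 2 := by
  intro hcard
  obtain ⟨x, y, hxy, rfl⟩ := Finset.card_eq_two.mp hcard
  have hy := h.2.1 y (by simp)
  have h4 := h.sum_eval_gegenbauerQ_four two_ne_zero (by simp) hy
  have h6 := h.sum_eval_gegenbauerQ_six two_ne_zero (by simp) hy
  rw [Finset.sum_pair hxy, real_inner_self_eq_norm_sq, hy, one_pow] at h4 h6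
  simp only [eval_gegenbauerQ_four 2 two_ne_zero] at h4
  simp only [eval_gegenbauerQ_six 2 two_ne_zero] at h6
  generalize (inner ℝ x y : ℝ) = t at h4 h6
  push_cast at h4 h6
  -- With `t = cos θ`, degree 4 says `cos 4θ = -1`, so `t² = 1/2`; then `cos 6θ = 0`, whereas degree
  -- 6 needs `-1`.
  have ht : (2 * t ^ 2 - 1) ^ 2 = 0 := by linear_combination h4 / 4
  have ht' : t ^ 2 = 1 / 2 := by
    have := pow_eq_zero_iff two_ne_zero |>.mp ht
    linarith
  have e4 : t ^ 4 = 1 / 4 := by linear_combination (t ^ 2 + 1 / 2) * ht'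
  have e6 : t ^ 6 = 1 / 8 := by linear_combination t ^ 2 * e4 + ht' / 4
  rw [ht', e4, e6] at h6
  norm_num at h6

/-! ### The Fisher type bound for harmonic index 6 in dimensions 3 and 4 -/

/-- The minimum of an even sextic at a critical point. -/
theorem minValue_of_critical {L : ℝ[X]} {A B K D y : ℝ} (hA : 0 < A)
    (hL : ∀ x, L.eval x = A * x ^ 6 + B * x ^ 4 + K * x ^ 2 + D) (hy0 : 0 ≤ y) (hy1 : y ≤ 1)
    (hcrit : 3 * A * y ^ 2 + 2 * B * y + K = 0) (hr : 0 ≤ 2 * A * y + B) :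
    minValue L = A * y ^ 3 + B * y ^ 2 + K * y + D := by
  have hy : √y ^ 2 = y := Real.sq_sqrt hy0
  refine minValue_eq (x₀ := √y) ⟨by linarith [Real.sqrt_nonneg y], Real.sqrt_le_one.mpr hy1⟩ ?_ ?_
  · have e4 : √y ^ 4 = y ^ 2 := by linear_combination (√y ^ 2 + y) * hy
    have e6 : √y ^ 6 = y ^ 3 := by linear_combination (√y ^ 4 + √y ^ 2 * y + y ^ 2) * hy
    rw [hL, hy, e4, e6]
  · intro x _
    -- Criticality makes `y` a double root in `x²`; `hr` says that the third root is not positive.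
    have e : L.eval x - (A * y ^ 3 + B * y ^ 2 + K * y + D) =
        (x ^ 2 - y) ^ 2 * (A * x ^ 2 + (2 * A * y + B)) := by
      rw [hL]
      linear_combination (x ^ 2 - y) * hcrit
    have : 0 ≤ (x ^ 2 - y) ^ 2 * (A * x ^ 2 + (2 * A * y + B)) := by positivity
    linarith

theorem abs_fisherBound_three : |fisherBound (gegenbauerQ 3 6) - 341 / 100| < 1 / 100 := by
  have h15 : √(15 : ℝ) ^ 2 = 15 := Real.sq_sqrt (by norm_num)
  have hl : 3.8729 < √(15 : ℝ) := Real.lt_sqrt_of_sq_lt (by norm_num)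
  have hu : √(15 : ℝ) < 3.8730 := (Real.sqrt_lt' (by norm_num)).mpr (by norm_num)
  -- `y` is the larger root of the derivative, `33 y² - 30 y + 5 = 0`.
  have hmin := minValue_of_critical (L := gegenbauerQ 3 6) (A := 13 / 16 * 231)
    (B := 13 / 16 * -315) (K := 13 / 16 * 105) (D := 13 / 16 * -5) (y := (15 + 2 * √15) / 33)
    (by norm_num) (fun x => by rw [eval_gegenbauerQ_six 3 three_ne_zero]; push_cast; ring)
    (by positivity) (by linarith) (by linear_combination (13 / 16 * 231 * 3 * 4 / 33 ^ 2) * h15)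
    (by linarith)
  have hval : minValue (gegenbauerQ 3 6) = -65 / 121 - 455 / 363 * √15 := by
    have h3 : √(15 : ℝ) ^ 3 = 15 * √15 := by linear_combination √15 * h15
    rw [hmin]
    ring_nf
    simp only [h3]
    ring
  have hone : (gegenbauerQ 3 6).eval 1 = 13 := by
    rw [eval_gegenbauerQ_six 3 three_ne_zero]; norm_num
  rw [fisherBound, hone, hval, abs_lt, lt_sub_iff_add_lt, sub_lt_iff_lt_add,
    lt_div_iff₀ (by linarith), div_lt_iff₀ (by linarith)]
  constructor <;> linarith

theorem abs_fisherBound_four : |fisherBound (gegenbauerQ 4 6) - 529 / 100| < 1 / 100 := by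
  have h7 : √(7 : ℝ) ^ 2 = 7 := Real.sq_sqrt (by norm_num)
  have hl : 2.6457 < √(7 : ℝ) := Real.lt_sqrt_of_sq_lt (by norm_num)
  have hu : √(7 : ℝ) < 2.6458 := (Real.sqrt_lt' (by norm_num)).mpr (by norm_num)
  -- `y` is the larger root of `24 y² - 20 y + 3 = 0`.
  have hmin := minValue_of_critical (L := gegenbauerQ 4 6) (A := 448)
    (B := -560) (K := 168) (D := -7) (y := (5 + √7) / 12)
    (by norm_num) (fun x => by rw [eval_gegenbauerQ_six 4 four_ne_zero]; push_cast; ring)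
    (by positivity) (by linarith) (by linear_combination (448 * 3 / 12 ^ 2) * h7)
    (by linarith)
  have hval : minValue (gegenbauerQ 4 6) = -49 / 27 - 98 / 27 * √7 := by
    have h3 : √(7 : ℝ) ^ 3 = 7 * √7 := by linear_combination √7 * h7
    rw [hmin]
    ring_nf
    simp only [h3]
    ring
  have hone : (gegenbauerQ 4 6).eval 1 = 49 := by
    rw [eval_gegenbauerQ_six 4 four_ne_zero]; norm_num
  rw [fisherBound, hone, hval, abs_lt, lt_sub_iff_add_lt, sub_lt_iff_lt_add,
    lt_div_iff₀ (by linarith), div_lt_iff₀ (by linarith)]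
  constructor <;> linarith

theorem fisherBound_lt_fisherBound_six {n : ℕ} (hn : n = 3 ∨ n = 4) {f : ℕ → ℝ}
    (hf : IsAdmissible n {6, 4} f) :
    fisherBound (testCombination n {6, 4} f) < fisherBound (gegenbauerQ n 6) := by
  rcases hn with rfl | rfl
  · have hb := (abs_lt.mp abs_fisherBound_three).1
    have hm : fisherBound (testCombination 3 {6, 4} f) ∈ ({0, 3} : Set ℝ) := by
      rw [← fisherBound_values_three]; exact ⟨f, hf, rfl⟩
    rcases hm with h | h <;> rw [h] <;> linarith
  · have hb := (abs_lt.mp abs_fisherBound_four).1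
    have hm : fisherBound (testCombination 4 {6, 4} f) ∈ ({2} : Set ℝ) := by
      rw [← fisherBound_values_four]; exact ⟨f, hf, rfl⟩
    rw [show _ = _ from hm]
    linarith

/-! ### Nonexistence of tight designs and the main theorem -/

theorem not_isTightHarmonicDesign_six_four {n : ℕ} (hn : 2 ≤ n)
    (Y : Finset (EuclideanSpace ℝ (Fin n))) : ¬ IsTightHarmonicDesign n {6, 4} Y := by
  rintro ⟨hY, f, hf, hcard⟩
  have hcases : n = 2 ∨ (n = 3 ∨ n = 4) ∨ 5 ≤ n := by lia
  rcases hcases with rfl | hn' | hn'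
  · have hm : fisherBound (testCombination 2 {6, 4} f) ∈ ({2} : Set ℝ) := by
      rw [← fisherBound_values_two]; exact ⟨f, hf, rfl⟩
    rw [show _ = _ from hm] at hcard
    exact hY.card_ne_two (by exact_mod_cast hcard)
  · have h1 := hY.fisherBound_le_card (by lia) (by simp)
    have h2 := fisherBound_lt_fisherBound_six hn' hf
    linarith
  · exact not_isAdmissible_six_four hn' f hf

theorem mainTheorem7 :
    -- there is no tight design of harmonic index {6,4} in any dimension
    (∀ n : ℕ, 2 ≤ n →
      ¬ ∃ Y : Finset (EuclideanSpace ℝ (Fin n)), IsTightHarmonicDesign n {6, 4} Y) ∧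
    -- the coefficient f₄ and α² required for a x² (x² - α²)² - c
    (∀ n : ℕ, 2 ≤ n → ∀ w : ℂ, w ^ 2 = -(((n : ℂ) + 6) * ((n : ℂ) - 4)) → ∀ z s : ℂ,
      IsComplexSolution n z s ↔
        (z = ((n : ℂ) + 10) / (10 * ((n : ℂ) + 4) * ((n : ℂ) + 6)) *
              (((n : ℂ) + 6) * ((n : ℂ) - 12) + 2 * ((n : ℂ) + 8) * w) ∧
          s = 3 * (2 * ((n : ℂ) + 6) - w) / (((n : ℂ) + 4) * ((n : ℂ) + 6))) ∨
        (z = ((n : ℂ) + 10) / (10 * ((n : ℂ) + 4) * ((n : ℂ) + 6)) *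
              (((n : ℂ) + 6) * ((n : ℂ) - 12) - 2 * ((n : ℂ) + 8) * w) ∧
          s = 3 * (2 * ((n : ℂ) + 6) + w) / (((n : ℂ) + 4) * ((n : ℂ) + 6)))) ∧
    -- for n ≥ 5 it is non-real, and no suitable test polynomial exists
    (∀ n : ℕ, 5 ≤ n →
      (∀ z s : ℂ, IsComplexSolution n z s → z.im ≠ 0) ∧
      ∀ f : ℕ → ℝ, ¬ IsAdmissible n {6, 4} f) ∧
    -- the values of the bound for n = 2, 3, 4
    {b : ℝ | ∃ f : ℕ → ℝ, IsAdmissible 2 {6, 4} f ∧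
      b = fisherBound (testCombination 2 {6, 4} f)} = {2} ∧
    {b : ℝ | ∃ f : ℕ → ℝ, IsAdmissible 3 {6, 4} f ∧
      b = fisherBound (testCombination 3 {6, 4} f)} = {0, 3} ∧
    {b : ℝ | ∃ f : ℕ → ℝ, IsAdmissible 4 {6, 4} f ∧
      b = fisherBound (testCombination 4 {6, 4} f)} = {2} ∧
    -- for n = 3, 4 the Fisher type bound for harmonic index 6 is larger
    (∀ n : ℕ, n = 3 ∨ n = 4 →
      (∀ Y : Finset (EuclideanSpace ℝ (Fin n)), IsHarmonicDesign n {6} Y →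
        fisherBound (gegenbauerQ n 6) ≤ (Y.card : ℝ)) ∧
      ∀ f : ℕ → ℝ, IsAdmissible n {6, 4} f →
        fisherBound (testCombination n {6, 4} f) < fisherBound (gegenbauerQ n 6)) ∧
    |fisherBound (gegenbauerQ 3 6) - 341 / 100| < 1 / 100 ∧
    |fisherBound (gegenbauerQ 4 6) - 529 / 100| < 1 / 100 := by
  refine ⟨fun n hn ⟨Y, hY⟩ => not_isTightHarmonicDesign_six_four hn Y hY,
    fun n hn w hw z s => isComplexSolution_iff_of_sq (by lia) hw z s,
    fun n hn => ⟨fun z s h => h.im_ne_zero hn, not_isAdmissible_six_four hn⟩,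
    fisherBound_values_two, fisherBound_values_three, fisherBound_values_four,
    fun n hn => ⟨fun Y hY => hY.fisherBound_le_card (by lia) (by simp),
      fun f hf => fisherBound_lt_fisherBound_six hn hf⟩,
    abs_fisherBound_three, abs_fisherBound_four⟩
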